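/- Let $\mathbb K=\mathbb R$ or $\mathbb C$. For a Banach space $X$ over $\mathbb K$ and $1\le q<\infty$, let $\ell_q^w(X)$ be the set of sequences $(x_j)_{j\ge1}$ in $X$ with $\sup_{\varphi\in B_{X^*}}\sum_j|\varphi(x_j)|^q<\infty$. For Banach spaces $X_1,\dots,X_n,Y$ over $\mathbb K$ and $p,q_1,\dots,q_n\in[1,\infty)$ with $\frac1p\le\frac1{q_1}+\cdots+\frac1{q_n}$, let $\Pi^n_{p;q_1,\dots,q_n}(X_1,\dots,X_n;Y)$ be the set of continuous $n$-linear operators $T:X_1\times\cdots\times X_n\to Y$ such that $\bigl(T(x_j^{(1)},\dots,x_j^{(n)})\bigr)_{j\ge1}\in\ell_p(Y)$ whenever $(x_j^{(k)})_{j\ge1}\in\ell_{q_k}^w(X_k)$ for $k=1,\dots,n$; write $\Pi^n_{p;q}$ when $q_1=\cdots=q_n=q$. Let $n\ge3$ and let $X_4,\dots,X_n,Y$ be arbitrary Banach spaces over $\mathbb K$. Then, for all $q\in[1,\infty)$ and all real $p,r$ with $1\le r<p<3/2$, $$\Pi^n_{p;p,p,p,q,\dots,q}(\ell_3,\ell_3,\ell_3,X_4,\dots,X_n;Y)\subseteq\Pi^n_{r;r,r,r,q,\dots,q}(\ell_3,\ell_3,\ell_3,X_4,\dots,X_n;Y),$$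 where the first three of the $n$ indices after the semicolon are $p$ (respectively $r$) and the remaining $n-3$ are $q$. In particular, for all $1\le r<p<3/2$, $$\Pi^n_{p;p}(\ell_3,\ell_3,\ell_3,X_4,\dots,X_n;Y)\subseteq\Pi^n_{r;r}(\ell_3,\ell_3,\ell_3,X_4,\dots,X_n;Y).$$ -/

import Mathlib

open scoped ENNReal

/-- The inequality making the sequence space `ℓ_3` a normed space. -/
instance one_le_three_fact : Fact ((1 : ℝ≥0∞) ≤ 3) := ⟨by norm_num⟩

/-- The Banach space `ℓ_3` of scalar sequences, with its usual norm. -/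
abbrev EllThree (𝕜 : Type*) [RCLike 𝕜] : Type _ := lp (fun _ : ℕ => 𝕜) 3

/-- `x ∈ ℓ_q^w(E)`: the supremum over the functionals `φ` in the closed unit ball of the dual
of `∑_j |φ (x_j)|^q` is finite (supremum and sum are taken in `[0, ∞]`). -/
def WeaklySummable (𝕜 : Type*) [RCLike 𝕜] {E : Type*} [NormedAddCommGroup E] [NormedSpace 𝕜 E]
    (q : ℝ) (x : ℕ → E) : Prop :=
  (⨆ φ : {φ : E →L[𝕜] 𝕜 // ‖φ‖ ≤ 1}, ∑' j, ‖φ.1 (x j)‖ₑ ^ q) < ∞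

/-- The class `Π^n_{p; q_1, …, q_n}(X_1, …, X_n; Y)` of absolutely `(p; q_1, …, q_n)`-summing
continuous `n`-linear operators. It is considered for positive real `p, q_1, …, q_n` with
`1/p ≤ 1/q_1 + ⋯ + 1/q_n`. -/
def absolutelySumming {𝕜 : Type*} [RCLike 𝕜] {n : ℕ} (X : Fin n → Type*) (Y : Type*)
    [∀ k, NormedAddCommGroup (X k)] [∀ k, NormedSpace 𝕜 (X k)]
    [NormedAddCommGroup Y] [NormedSpace 𝕜 Y] (p : ℝ) (q : Fin n → ℝ) :
    Set (ContinuousMultilinearMap 𝕜 X Y) :=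
  {T | ∀ x : (k : Fin n) → ℕ → X k, (∀ k, WeaklySummable 𝕜 (q k) (x k)) →
    Memℓp (fun j => T (fun k => x k j)) (ENNReal.ofReal p)}

/-- The exponents `(a, a, a, q, …, q)`: the first three entries are `a`, the others `q`. -/
def firstThree {n : ℕ} (a q : ℝ) : Fin n → ℝ := fun k => if k.val < 3 then a else q

/-! Freezing every argument of `T` except one `ℓ_3` argument leaves a sequence of operators `v_j` on
`ℓ_3`. Weak `r`-summability implies weak `p`-summability in the frozen slots, so `(v_j)` takes
`ℓ_p^w` to `ℓ_p(Y)`. One `ℓ_3` factor suffices. Multiplying by scalars from `ℓ_{r'}` reduces the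
claim to showing that `(v_j)` takes `ℓ_1^w` to `ℓ_1`.

For a finite index set `s`, let `β` be the best constant in that `ℓ_1` estimate and let `z`, of weak
`ℓ_1` norm at most `1`, nearly attain it. By the Clarkson inequality, deleting a block `A` with
`‖∑_A g_j z_j‖ = τ`, `|g_j| ≤ 1`, lowers the weak `ℓ_1` norm to at most `(1 - τ³)^{1/3}`.
Near-maximality then forces `A` to carry a share of the sum of order at least `τ³`, up to a small
error (`CubeClarkson.restricted_of_almost_max`). Summing this over dyadic level sets gives a
weighted `ℓ_t` bound for every `t > 3` (`norm_sum_le_of_restricted`).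

The condition `p < 3/2` says exactly that `t = p' > 3`. Hence, with `μ` the normalized mass, `y_j =
μ_j^{-1/t} z_j` has a controlled weak `ℓ_p` norm. The hypothesis applied to `y`, followed by Hölder,
bounds `β` independently of `s` (`CubeClarkson.max_le`). -/

/-! ### Clarkson inequality in `ℓ_3` -/

/-- The inequality `2 (‖x‖³ + ‖y‖³) ≤ ‖x + y‖³ + ‖x - y‖³` of Clarkson type. -/
def CubeClarkson (E : Type*) [NormedAddCommGroup E] : Prop :=
  ∀ x y : E, 2 * (‖x‖ ^ 3 + ‖y‖ ^ 3) ≤ ‖x + y‖ ^ 3 + ‖x - y‖ ^ 3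

/-- Convexity of `u ↦ u^{3/2}`: `tangent` is its tangent line at `u = m²`, taken at `u = c²` and `u
= d²`, whose mean is `m²`. -/
lemma two_mul_sum_cubes_le {a b c d : ℝ} (hc : 0 ≤ c) (hd : 0 ≤ d)
    (h : c ^ 2 + d ^ 2 = 2 * (a ^ 2 + b ^ 2)) : 2 * (a ^ 3 + b ^ 3) ≤ c ^ 3 + d ^ 3 := by
  set m := √(a ^ 2 + b ^ 2) with hm
  have hm0 : 0 ≤ m := Real.sqrt_nonneg _
  have hm2 : m ^ 2 = a ^ 2 + b ^ 2 := Real.sq_sqrt (by positivity)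
  have ham : a ≤ m := Real.le_sqrt_of_sq_le (by nlinarith [sq_nonneg b])
  have hbm : b ≤ m := Real.le_sqrt_of_sq_le (by nlinarith [sq_nonneg a])
  have h1 : a ^ 3 + b ^ 3 ≤ m ^ 3 := by
    nlinarith [mul_nonneg (sq_nonneg a) (sub_nonneg.2 ham),
      mul_nonneg (sq_nonneg b) (sub_nonneg.2 hbm)]
  have tangent : ∀ c : ℝ, 0 ≤ c → 3 * m * c ^ 2 ≤ 2 * c ^ 3 + m ^ 3 := fun c hc => by
    nlinarith [mul_nonneg (sq_nonneg (c - m)) (by positivity : 0 ≤ 2 * c + m)]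
  nlinarith [tangent c hc, tangent d hd, congrArg (fun x => m * x) h]

lemma cubeClarkson_rclike (𝕜 : Type*) [RCLike 𝕜] : CubeClarkson 𝕜 := fun x y => by
  refine two_mul_sum_cubes_le (norm_nonneg _) (norm_nonneg _) ?_
  have := parallelogram_law_with_norm 𝕜 x y
  nlinarith

lemma cubeClarkson_ellThree (𝕜 : Type*) [RCLike 𝕜] : CubeClarkson (EllThree 𝕜) := fun x y => by
  have key : ∀ f : EllThree 𝕜, HasSum (fun i => ‖f i‖ ^ 3) (‖f‖ ^ 3) := fun f => by
    have h3 : (3 : ℝ≥0∞).toReal = ((3 : ℕ) : ℝ) := by norm_num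
    have := lp.hasSum_norm (p := 3) (by norm_num) f
    simpa only [h3, Real.rpow_natCast] using this
  refine hasSum_le (fun i => ?_) (((key x).add (key y)).mul_left 2) ((key (x + y)).add (key (x - y)))
  simpa using cubeClarkson_rclike 𝕜 (x i) (y i)

lemma CubeClarkson.of_linearIsometryEquiv {𝕜 E F : Type*} [RCLike 𝕜] [NormedAddCommGroup E]
    [NormedSpace 𝕜 E] [NormedAddCommGroup F] [NormedSpace 𝕜 F] (e : E ≃ₗᵢ[𝕜] F)
    (hF : CubeClarkson F) : CubeClarkson E := fun x y => by
  simpa [← map_add, ← map_sub] using hF (e x) (e y)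

/-! ### Weak summability and `ℓ_p` duality -/

section WeaklySummable

variable {𝕜 E : Type*} [RCLike 𝕜] [NormedAddCommGroup E] [NormedSpace 𝕜 E]

lemma weaklySummable_iff {q : ℝ} (hq : 0 < q) {x : ℕ → E} :
    WeaklySummable 𝕜 q x ↔ ∃ W : ℝ, 0 ≤ W ∧ ∀ φ : E →L[𝕜] 𝕜, ‖φ‖ ≤ 1 → ∀ s : Finset ℕ,
      ∑ j ∈ s, ‖φ (x j)‖ ^ q ≤ W ^ q := by
  have conv : ∀ (φ : E →L[𝕜] 𝕜) (s : Finset ℕ),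
      ∑ j ∈ s, ‖φ (x j)‖ₑ ^ q = ENNReal.ofReal (∑ j ∈ s, ‖φ (x j)‖ ^ q) := fun φ s => by
    rw [ENNReal.ofReal_sum_of_nonneg fun j _ => by positivity]
    refine Finset.sum_congr rfl fun j _ => ?_
    rw [← ofReal_norm, ENNReal.ofReal_rpow_of_nonneg (norm_nonneg _) hq.le]
  unfold WeaklySummable
  constructor
  · intro h
    refine ⟨(⨆ φ : {φ : E →L[𝕜] 𝕜 // ‖φ‖ ≤ 1}, ∑' j, ‖φ.1 (x j)‖ₑ ^ q).toReal ^ (1 / q),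
      by positivity, fun φ hφ s => ?_⟩
    rw [← Real.rpow_mul ENNReal.toReal_nonneg, one_div_mul_cancel hq.ne', Real.rpow_one,
      ← ENNReal.ofReal_le_iff_le_toReal h.ne, ← conv]
    exact (ENNReal.sum_le_tsum s).trans
      (le_iSup (fun φ : {φ : E →L[𝕜] 𝕜 // ‖φ‖ ≤ 1} => ∑' j, ‖φ.1 (x j)‖ₑ ^ q) ⟨φ, hφ⟩)
  · rintro ⟨W, -, h⟩
    refine lt_of_le_of_lt (iSup_le fun φ => ?_) (ENNReal.ofReal_lt_top (r := W ^ q))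
    rw [ENNReal.tsum_eq_iSup_sum]
    refine iSup_le fun s => ?_
    rw [conv]
    exact ENNReal.ofReal_le_ofReal (h φ.1 φ.2 s)

lemma WeaklySummable.mono {r p : ℝ} (hr : 0 < r) (hrp : r ≤ p) {x : ℕ → E}
    (hx : WeaklySummable 𝕜 r x) : WeaklySummable 𝕜 p x := by
  rw [weaklySummable_iff hr] at hx
  obtain ⟨W, hW, h⟩ := hx
  refine (weaklySummable_iff (hr.trans_le hrp)).2 ⟨W, hW, fun φ hφ s => ?_⟩
  have hj : ∀ j, ‖φ (x j)‖ ≤ W := fun j => by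
    have := h φ hφ {j}
    rw [Finset.sum_singleton] at this
    exact (Real.rpow_le_rpow_iff (norm_nonneg _) hW hr).1 this
  have split : ∀ a : ℝ, 0 ≤ a → a ^ p = a ^ r * a ^ (p - r) := fun a ha => by
    rw [← Real.rpow_add_of_nonneg ha hr.le (sub_nonneg.2 hrp)]; ring_nf
  calc ∑ j ∈ s, ‖φ (x j)‖ ^ p ≤ ∑ j ∈ s, ‖φ (x j)‖ ^ r * W ^ (p - r) := by
        refine Finset.sum_le_sum fun j _ => ?_
        rw [split _ (norm_nonneg _)]
        have := sub_nonneg.2 hrp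
        gcongr
        exact hj j
    _ ≤ W ^ r * W ^ (p - r) := by
        rw [← Finset.sum_mul]
        gcongr
        exact h φ hφ s
    _ = W ^ p := (split W hW).symm

end WeaklySummable

lemma Real.sum_rpow_le_of_dual {ι : Type*} (s : Finset ι) {c : ι → ℝ} (hc : ∀ i, 0 ≤ c i)
    {p t : ℝ} (hpt : p.HolderConjugate t) {C : ℝ}
    (h : ∀ a : ι → ℝ, (∀ i, 0 ≤ a i) → ∑ i ∈ s, a i ^ t ≤ 1 → ∑ i ∈ s, c i * a i ≤ C) :
    ∑ i ∈ s, c i ^ p ≤ C ^ p := by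
  lift c to ι → NNReal using hc
  obtain ⟨a, ha, hac⟩ := (NNReal.isGreatest_Lp s c hpt).1
  have h1 := h (fun i => a i) (fun i => (a i).2) (by exact_mod_cast (show _ ≤ (1 : NNReal) from ha))
  have h2 : ((∑ i ∈ s, c i ^ p : NNReal) : ℝ) ^ (1 / p) ≤ C := by
    refine le_trans (le_of_eq ?_) h1
    rw [← NNReal.coe_rpow, ← hac]
    push_cast
    rfl
  have h3 := Real.rpow_le_rpow (by positivity) h2 hpt.nonneg
  rw [← Real.rpow_mul (by positivity), one_div_mul_cancel hpt.ne_zero, Real.rpow_one] at h3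
  simpa using h3

/-! ### From restricted to weighted `ℓ_t` estimates -/

section Layers

variable {𝕜 X ι : Type*} [RCLike 𝕜] [NormedAddCommGroup X] [NormedSpace 𝕜 X]

/-- A restricted estimate of order `3` on level sets gives an estimate in weighted `ℓ_t`, `t > 3`. -/
lemma norm_sum_le_of_restricted {t : ℝ} (ht : 3 < t) {s : Finset ι} {z : ι → X} {μ : ι → ℝ}
    (hμ : ∀ j, 0 ≤ μ j) (hμs : ∑ j ∈ s, μ j ≤ 2)
    (hA : ∀ A ⊆ s, ∀ c : ℝ, 0 ≤ c → ∀ h : ι → 𝕜, (∀ j ∈ A, ‖h j‖ ≤ c) →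
      ‖∑ j ∈ A, h j • z j‖ ^ 3 ≤ 6 * c ^ 3 * ∑ j ∈ A, μ j)
    {g : ι → 𝕜} (hg : ∑ j ∈ s, ‖g j‖ ^ t * μ j ≤ 1) :
    ‖∑ j ∈ s, g j • z j‖ ≤ 3 + 4 * (1 - (2 : ℝ) ^ ((3 - t) / 3))⁻¹ := by
  set ρ : ℝ := (2 : ℝ) ^ ((3 - t) / 3) with hρ
  have hρ0 : 0 < ρ := by positivity
  have hρ1 : ρ < 1 := Real.rpow_lt_one_of_one_lt_of_neg (by norm_num) (by linarith)
  have step : ∀ M : ℕ, ∀ A ⊆ s, (∀ j ∈ A, ‖g j‖ ≤ 2 ^ M) →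
      ‖∑ j ∈ A, g j • z j‖ ≤ 3 + 4 * ∑ m ∈ Finset.range M, ρ ^ m := by
    intro M
    induction M with
    | zero =>
      intro A hAs hgA
      have h1 := hA A hAs 1 zero_le_one g (by simpa using hgA)
      have h2 : ∑ j ∈ A, μ j ≤ 2 :=
        (Finset.sum_le_sum_of_subset_of_nonneg hAs fun j _ _ => hμ j).trans hμs
      have h3 : ‖∑ j ∈ A, g j • z j‖ ^ 3 ≤ 3 ^ 3 := by nlinarith
      simpa using le_of_pow_le_pow_left₀ (by norm_num) (by norm_num) h3
    | succ M ih =>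
      intro A hAs hgA
      classical
      set b : ℝ := 2 ^ M with hb
      have hb0 : 0 < b := by positivity
      have hs1 : A.filter (fun j => ‖g j‖ ≤ b) ⊆ s := (Finset.filter_subset _ _).trans hAs
      have hs2 : A.filter (fun j => ¬ ‖g j‖ ≤ b) ⊆ s := (Finset.filter_subset _ _).trans hAs
      have low := ih _ hs1 fun j hj => (Finset.mem_filter.1 hj).2
      have high := hA _ hs2 (2 * b) (by positivity) g fun j hj => by
        have := hgA j (Finset.mem_filter.1 hj).1
        rwa [pow_succ, mul_comm] at this
      -- Chebyshev's inequality for the weighted sum `hg`.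
      have meas : ∑ j ∈ A.filter (fun j => ¬ ‖g j‖ ≤ b), μ j ≤ b ^ (-t) := by
        have h1 : b ^ t * ∑ j ∈ A.filter (fun j => ¬ ‖g j‖ ≤ b), μ j ≤ 1 := by
          refine le_trans ?_ ((Finset.sum_le_sum_of_subset_of_nonneg hs2 fun j _ _ =>
            mul_nonneg (Real.rpow_nonneg (norm_nonneg (g j)) t) (hμ j)).trans hg)
          rw [Finset.mul_sum]
          refine Finset.sum_le_sum fun j hj => mul_le_mul_of_nonneg_right ?_ (hμ j)
          exact Real.rpow_le_rpow hb0.le (not_le.1 (Finset.mem_filter.1 hj).2).le (by linarith)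
        rw [Real.rpow_neg hb0.le, ← one_div, le_div_iff₀ (by positivity), mul_comm]
        exact h1
      have hρM : (ρ ^ M) ^ 3 = b ^ 3 * b ^ (-t) := by
        rw [hρ, hb, ← Real.rpow_natCast (2 : ℝ) M, ← Real.rpow_natCast _ 3, ← Real.rpow_natCast _ 3,
          ← Real.rpow_natCast _ M]
        simp only [← Real.rpow_mul (zero_le_two (α := ℝ)), ← Real.rpow_add (zero_lt_two (α := ℝ))]
        congr 1
        push_cast
        ring
      -- The restricted estimate gives `6 (2b)³ b^{-t} = 48 (ρ^M)³ ≤ (4 ρ^M)³`; `t > 3` makes the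
      -- layers geometrically summable.
      have high' : ‖∑ j ∈ A.filter (fun j => ¬ ‖g j‖ ≤ b), g j • z j‖ ≤ 4 * ρ ^ M := by
        refine le_of_pow_le_pow_left₀ (n := 3) (by norm_num) (by positivity) (high.trans ?_)
        rw [mul_pow 4, hρM]
        have := mul_le_mul_of_nonneg_left meas (by positivity : 0 ≤ 6 * (2 * b) ^ 3)
        have h4 : 0 ≤ b ^ 3 * b ^ (-t) := by positivity
        nlinarith
      rw [← Finset.sum_filter_add_sum_filter_not A (fun j => ‖g j‖ ≤ b), Finset.sum_range_succ]
      refine (norm_add_le _ _).trans ?_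
      linarith
  obtain ⟨M, hM⟩ := pow_unbounded_of_one_lt (∑ j ∈ s, ‖g j‖) (one_lt_two (α := ℝ))
  refine (step M s subset_rfl fun j hj => ?_).trans ?_
  · exact (Finset.single_le_sum (f := fun j => ‖g j‖) (fun _ _ => norm_nonneg _) hj).trans hM.le
  · gcongr
    rw [← tsum_geometric_of_lt_one hρ0.le hρ1]
    exact (summable_geometric_of_lt_one hρ0.le hρ1).sum_le_tsum _ fun _ _ => by positivity

end Layers

/-! ### Uniform bounds and almost extremal systems -/

section Bounds

variable {𝕜 X Y : Type*} [RCLike 𝕜] [NormedAddCommGroup X] [NormedSpace 𝕜 X]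
  [NormedAddCommGroup Y] [NormedSpace 𝕜 Y]

/-- Each `φ ∘ u` is a functional on `ℓ_t`, so its coordinates have `ℓ_p` norm at most `‖u‖`. Weakly
summable sequences can thus be drawn from a Banach space of operators, where Banach–Steinhaus
applies. -/
lemma weaklySummable_apply_single {p t : ℝ} (hpt : p.HolderConjugate t)
    [Fact (1 ≤ ENNReal.ofReal t)] (u : lp (fun _ : ℕ => 𝕜) (ENNReal.ofReal t) →L[𝕜] X) :
    WeaklySummable 𝕜 p (fun j => u (lp.single _ j 1)) := by
  have htr : (ENNReal.ofReal t).toReal = t := ENNReal.toReal_ofReal hpt.symm.nonneg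
  refine (weaklySummable_iff hpt.pos).2 ⟨‖u‖, norm_nonneg _, fun φ hφ s => ?_⟩
  refine Real.sum_rpow_le_of_dual s (fun _ => norm_nonneg _) hpt fun a ha hat => ?_
  choose f hf1 hf using fun j => RCLike.exists_norm_eq_mul_self (φ (u (lp.single _ j 1)))
  set w : lp (fun _ : ℕ => 𝕜) (ENNReal.ofReal t) := ∑ j ∈ s, lp.single _ j (f j * (a j : 𝕜)) with hw
  have hwn : ‖w‖ ≤ 1 := by
    have h1 := lp.norm_sum_single (p := ENNReal.ofReal t) (by rw [htr]; exact hpt.symm.pos)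
      (fun j => f j * (a j : 𝕜)) s
    simp only [htr, norm_mul, hf1, one_mul, RCLike.norm_ofReal, abs_of_nonneg (ha _)] at h1
    rw [← hw] at h1
    rw [← h1] at hat
    by_contra! h
    exact absurd hat (not_le.2 (Real.one_lt_rpow h hpt.symm.pos))
  have hval : φ (u w) = ((∑ j ∈ s, ‖φ (u (lp.single _ j 1))‖ * a j : ℝ) : 𝕜) := by
    rw [hw, map_sum, map_sum]
    push_cast
    refine Finset.sum_congr rfl fun j _ => ?_
    have : lp.single (E := fun _ : ℕ => 𝕜) (ENNReal.ofReal t) j (f j * (a j : 𝕜))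
        = (f j * (a j : 𝕜)) • lp.single _ j 1 := by
      rw [← lp.single_smul]; simp
    rw [this, map_smul, map_smul, smul_eq_mul]
    linear_combination -(a j : 𝕜) * hf j
  calc _ ≤ ‖φ (u w)‖ := by rw [hval, RCLike.norm_ofReal]; exact le_abs_self _
    _ ≤ ‖φ‖ * (‖u‖ * ‖w‖) := (φ.le_opNorm _).trans (by gcongr; exact u.le_opNorm _)
    _ ≤ 1 * (‖u‖ * 1) := by gcongr
    _ = ‖u‖ := by ring

/-- Uniform boundedness: a sequence of operators mapping `ℓ_p^w(X)` to `ℓ_p(Y)` does so boundedly. -/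
lemma exists_uniform_bound [CompleteSpace X] {p t : ℝ} (hpt : p.HolderConjugate t)
    {v : ℕ → X →L[𝕜] Y}
    (H : ∀ y, WeaklySummable 𝕜 p y → Memℓp (fun j => v j (y j)) (ENNReal.ofReal p)) :
    ∃ K : ℝ, 0 ≤ K ∧ ∀ (s : Finset ℕ) (y : ℕ → X) (C : ℝ), 0 ≤ C →
      (∀ a : ℕ → 𝕜, ∑ j ∈ s, ‖a j‖ ^ t ≤ 1 → ‖∑ j ∈ s, a j • y j‖ ≤ C) →
      ∑ j ∈ s, ‖v j (y j)‖ ^ p ≤ (K * C) ^ p := by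
  have htr : (ENNReal.ofReal t).toReal = t := ENNReal.toReal_ofReal hpt.symm.nonneg
  have hpr : (ENNReal.ofReal p).toReal = p := ENNReal.toReal_ofReal hpt.nonneg
  have : Fact (1 ≤ ENNReal.ofReal t) := ⟨by simpa using hpt.symm.lt.le⟩
  have : Fact (1 ≤ ENNReal.ofReal p) := ⟨by simpa using hpt.lt.le⟩
  let g : Finset ℕ → (lp (fun _ : ℕ => 𝕜) (ENNReal.ofReal t) →L[𝕜] X) →L[𝕜]
      lp (fun _ : ℕ => Y) (ENNReal.ofReal p) := fun s =>
    ∑ j ∈ s, (lp.singleContinuousLinearMap 𝕜 (fun _ : ℕ => Y) (ENNReal.ofReal p) j) ∘L (v j) ∘L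
      (ContinuousLinearMap.apply 𝕜 X (lp.single _ j 1))
  have hg : ∀ s u, ‖g s u‖ ^ p = ∑ j ∈ s, ‖v j (u (lp.single _ j 1))‖ ^ p := fun s u => by
    have h1 := lp.norm_sum_single (p := ENNReal.ofReal p) (by rw [hpr]; exact hpt.pos)
      (fun j => v j (u (lp.single _ j 1))) s
    rw [hpr] at h1
    rw [← h1]
    simp [g]
  obtain ⟨K, hK⟩ := banach_steinhaus (g := g) fun u => by
    obtain ⟨C, hC0, hC⟩ := (memℓp_gen_iff'' (by rw [hpr]; exact hpt.pos)).1
      (H _ (weaklySummable_apply_single hpt u))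
    refine ⟨C ^ (1 / p), fun s => ?_⟩
    rw [← Real.rpow_le_rpow_iff (norm_nonneg _) (by positivity) hpt.pos, hg,
      ← Real.rpow_mul hC0, one_div_mul_cancel hpt.ne_zero, Real.rpow_one]
    simpa only [hpr] using hC s
  have hK0 : 0 ≤ K := (norm_nonneg _).trans (hK ∅)
  refine ⟨K, hK0, fun s y C hC hy => ?_⟩
  -- Conversely, finitely many vectors are encoded by the operator sending `e_j` to `y_j` for `j ∈
  -- s`.
  let u : lp (fun _ : ℕ => 𝕜) (ENNReal.ofReal t) →L[𝕜] X :=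
    ∑ j ∈ s, (lp.evalCLM 𝕜 (fun _ : ℕ => 𝕜) (ENNReal.ofReal t) j).smulRight (y j)
  have hu : ∀ f, u f = ∑ j ∈ s, f j • y j := fun f => by
    simp [u, lp.evalCLM]
  have hun : ‖u‖ ≤ C := by
    refine u.opNorm_le_bound hC fun f => ?_
    rcases eq_or_ne f 0 with rfl | hf
    · simp
    have hf0 : 0 < ‖f‖ := norm_pos_iff.2 hf
    have h1 : ‖(((‖f‖⁻¹ : ℝ) : 𝕜)) • f‖ = 1 := by
      rw [norm_smul, RCLike.norm_ofReal, abs_of_pos (by positivity), inv_mul_cancel₀ hf0.ne']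
    have h2 := hy (fun j => ((((‖f‖⁻¹ : ℝ) : 𝕜)) • f) j) (by
      have := lp.sum_rpow_le_norm_rpow (by rw [htr]; exact hpt.symm.pos)
        ((((‖f‖⁻¹ : ℝ) : 𝕜)) • f) s
      rwa [htr, h1, Real.one_rpow] at this)
    rw [← hu, map_smul, norm_smul, RCLike.norm_ofReal, abs_of_pos (by positivity),
      inv_mul_le_iff₀ hf0] at h2
    linarith
  have hgu : ∑ j ∈ s, ‖v j (y j)‖ ^ p = ‖g s u‖ ^ p := by
    rw [hg]
    refine Finset.sum_congr rfl fun j hj => ?_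
    rw [hu, Finset.sum_eq_single_of_mem j hj fun i _ hij => by
      rw [lp.single_apply_ne _ _ _ hij, zero_smul]]
    rw [lp.single_apply_self, one_smul]
  rw [hgu]
  exact Real.rpow_le_rpow (norm_nonneg _)
    (((g s).le_opNorm u).trans (mul_le_mul (hK s) hun (norm_nonneg _) hK0)) hpt.nonneg

/-- Changing the sign of the block `A` keeps the coefficients admissible, so both `x + y` and `x -
y` in the Clarkson inequality have norm at most `1`. -/
lemma CubeClarkson.norm_sdiff_add_le {ι : Type*} [DecidableEq ι] (hX : CubeClarkson X)
    {s A : Finset ι} (hA : A ⊆ s) {z : ι → X}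
    (hz : ∀ f : ι → 𝕜, (∀ j, ‖f j‖ ≤ 1) → ‖∑ j ∈ s, f j • z j‖ ≤ 1) {f g : ι → 𝕜}
    (hf : ∀ j, ‖f j‖ ≤ 1) (hg : ∀ j ∈ A, ‖g j‖ ≤ 1) :
    ‖∑ j ∈ s \ A, f j • z j‖ ^ 3 + ‖∑ j ∈ A, g j • z j‖ ^ 3 ≤ 1 := by
  have key : ∀ k : ι → 𝕜, (∀ j ∈ A, ‖k j‖ ≤ 1) →
      ‖∑ j ∈ s \ A, f j • z j + ∑ j ∈ A, k j • z j‖ ≤ 1 := fun k hk => by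
    refine le_trans (le_of_eq ?_) (hz (fun j => if j ∈ A then k j else f j) fun j => ?_)
    · rw [← Finset.sum_sdiff hA]
      congr 2
      · exact Finset.sum_congr rfl fun j hj => by rw [if_neg (Finset.mem_sdiff.1 hj).2]
      · exact Finset.sum_congr rfl fun j hj => by rw [if_pos hj]
    · split_ifs with h
      exacts [hk j h, hf j]
  have h1 := key g hg
  have h2 := key (fun j => - g j) (by simpa using hg)
  simp only [neg_smul, Finset.sum_neg_distrib, ← sub_eq_add_neg] at h2
  have h3 := hX (∑ j ∈ s \ A, f j • z j) (∑ j ∈ A, g j • z j)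
  have h4 := pow_le_one₀ (n := 3) (norm_nonneg _) h1
  have h5 := pow_le_one₀ (n := 3) (norm_nonneg _) h2
  linarith

/-- A system `z` almost maximizing `∑ ‖v_j z_j‖` among those of weak `ℓ_1` norm at most `1`
satisfies a restricted estimate with respect to the measure `‖v_j z_j‖`. -/
lemma CubeClarkson.restricted_of_almost_max {ι : Type*} (hX : CubeClarkson X) {v : ι → X →L[𝕜] Y}
    {s : Finset ι} {β ε : ℝ} (hβ : 0 < β)
    (hmax : ∀ z : ι → X, ∀ c : ℝ, 0 < c →
      (∀ f : ι → 𝕜, (∀ j, ‖f j‖ ≤ 1) → ‖∑ j ∈ s, f j • z j‖ ≤ c) →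
      ∑ j ∈ s, ‖v j (z j)‖ ≤ β * c)
    {z : ι → X} (hz : ∀ f : ι → 𝕜, (∀ j, ‖f j‖ ≤ 1) → ‖∑ j ∈ s, f j • z j‖ ≤ 1)
    (hzβ : β * (1 - ε) ≤ ∑ j ∈ s, ‖v j (z j)‖) {A : Finset ι} (hA : A ⊆ s) {g : ι → 𝕜}
    (hg : ∀ j ∈ A, ‖g j‖ ≤ 1) :
    ‖∑ j ∈ A, g j • z j‖ ^ 3 ≤ 3 * ∑ j ∈ A, ‖v j (z j)‖ / β + 3 * ε := by
  classical
  set τ := ‖∑ j ∈ A, g j • z j‖ with hτ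
  have hτ0 : 0 ≤ τ := norm_nonneg _
  have hτ1 : τ ^ 3 ≤ 1 := by
    have := hX.norm_sdiff_add_le hA hz (f := fun _ => 0) (by simp) hg
    simpa using this
  -- The deleted system has weak norm at most `1 - τ³/3`, because `1 - τ³ ≤ (1 - τ³/3)³`.
  have h1 := hmax (fun j => if j ∈ A then 0 else z j) (1 - τ ^ 3 / 3) (by linarith) fun f hf => by
    have h2 : ∑ j ∈ s, f j • (if j ∈ A then 0 else z j) = ∑ j ∈ s \ A, f j • z j := by
      rw [← Finset.sum_sdiff hA, Finset.sum_congr rfl fun j hj => by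
        rw [if_neg (Finset.mem_sdiff.1 hj).2], Finset.sum_eq_zero (s := A) fun j hj => by
        rw [if_pos hj, smul_zero], add_zero]
    rw [h2]
    have h3 := hX.norm_sdiff_add_le hA hz hf hg
    refine le_of_pow_le_pow_left₀ (n := 3) (by norm_num) (by linarith) ?_
    have h4 : 0 ≤ τ ^ 3 := by positivity
    nlinarith [mul_nonneg (mul_nonneg h4 h4) (by linarith : 0 ≤ 9 - τ ^ 3)]
  have h5 : ∑ j ∈ s, ‖v j (if j ∈ A then 0 else z j)‖
      = ∑ j ∈ s, ‖v j (z j)‖ - ∑ j ∈ A, ‖v j (z j)‖ := by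
    rw [← Finset.sum_sdiff hA, ← Finset.sum_sdiff (f := fun j => ‖v j (z j)‖) hA,
      Finset.sum_congr rfl fun j hj => by rw [if_neg (Finset.mem_sdiff.1 hj).2],
      Finset.sum_eq_zero (s := A) fun j hj => by rw [if_pos hj, map_zero, norm_zero]]
    ring
  rw [h5] at h1
  rw [← Finset.sum_div]
  have h6 : β * τ ^ 3 ≤ 3 * ∑ j ∈ A, ‖v j (z j)‖ + β * (3 * ε) := by nlinarith
  have h7 : ∑ j ∈ A, ‖v j (z j)‖ = β * ((∑ j ∈ A, ‖v j (z j)‖) / β) := by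
    field_simp
  rw [h7] at h6
  refine le_of_mul_le_mul_left ?_ hβ
  linarith

end Bounds

/-! ### Extrapolation from `p` down to `1`, then up to `r` -/

section Extrapolation

variable {𝕜 X Y : Type*} [RCLike 𝕜] [NormedAddCommGroup X] [NormedSpace 𝕜 X]
  [NormedAddCommGroup Y] [NormedSpace 𝕜 Y]

/-- The least bound of `∑_{j ∈ s} ‖v_j z_j‖` by the weak `ℓ_1` norm of `z` does not depend on `s`. -/
lemma CubeClarkson.max_le (hX : CubeClarkson X) {p t : ℝ} (hpt : p.HolderConjugate t)
    (ht : 3 < t) {v : ℕ → X →L[𝕜] Y} {K : ℝ} {s : Finset ℕ}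
    (hK : ∀ (y : ℕ → X) (C : ℝ), 0 ≤ C →
      (∀ a : ℕ → 𝕜, ∑ j ∈ s, ‖a j‖ ^ t ≤ 1 → ‖∑ j ∈ s, a j • y j‖ ≤ C) →
      ∑ j ∈ s, ‖v j (y j)‖ ^ p ≤ (K * C) ^ p) (hK0 : 0 ≤ K) {β : ℝ} (hβ : 0 < β)
    (hmax : ∀ z : ℕ → X, ∀ c : ℝ, 0 < c →
      (∀ f : ℕ → 𝕜, (∀ j, ‖f j‖ ≤ 1) → ‖∑ j ∈ s, f j • z j‖ ≤ c) →
      ∑ j ∈ s, ‖v j (z j)‖ ≤ β * c)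
    (hs : s.Nonempty)
    (happrox : ∀ β' < β, ∃ z : ℕ → X,
      (∀ f : ℕ → 𝕜, (∀ j, ‖f j‖ ≤ 1) → ‖∑ j ∈ s, f j • z j‖ ≤ 1) ∧
      β' < ∑ j ∈ s, ‖v j (z j)‖) :
    β ≤ 4 * (K * (3 + 4 * (1 - (2 : ℝ) ^ ((3 - t) / 3))⁻¹)) := by
  set C : ℝ := 3 + 4 * (1 - (2 : ℝ) ^ ((3 - t) / 3))⁻¹ with hC
  have hC0 : 0 ≤ C := by
    have : (2 : ℝ) ^ ((3 - t) / 3) < 1 :=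
      Real.rpow_lt_one_of_one_lt_of_neg (by norm_num) (by linarith)
    have : 0 ≤ (1 - (2 : ℝ) ^ ((3 - t) / 3))⁻¹ := inv_nonneg.2 (by linarith)
    positivity
  have hcard : (1 : ℝ) ≤ s.card := by exact_mod_cast hs.card_pos
  -- Adding `ε` to each weight makes it positive and costs at most `1` in total, while any nonempty
  -- `A` then has `μ(A) ≥ ε`. This absorbs the error `3ε` and turns the constant `3` into `6`.
  set ε : ℝ := 1 / (s.card + 1) with hε
  have hε0 : 0 < ε := by positivity
  have hε2 : ε ≤ 1 / 2 := by
    rw [hε]; exact one_div_le_one_div_of_le (by norm_num) (by linarith)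
  have hεs : s.card * ε ≤ 1 := by
    rw [hε, mul_one_div, div_le_one (by positivity)]; linarith
  obtain ⟨z, hz, hzβ⟩ := happrox (β * (1 - ε)) (by nlinarith)
  set μ : ℕ → ℝ := fun j => ‖v j (z j)‖ / β + ε with hμ
  have hμ0 : ∀ j, 0 < μ j := fun j => by positivity
  have hμs : ∑ j ∈ s, μ j ≤ 2 := by
    have h1 := hmax z 1 one_pos hz
    rw [Finset.sum_add_distrib, ← Finset.sum_div, Finset.sum_const, nsmul_eq_mul]
    have h2 : (∑ j ∈ s, ‖v j (z j)‖) / β ≤ 1 := by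
      rw [div_le_one hβ]; linarith
    linarith
  have restricted : ∀ A ⊆ s, ∀ c : ℝ, 0 ≤ c → ∀ h : ℕ → 𝕜, (∀ j ∈ A, ‖h j‖ ≤ c) →
      ‖∑ j ∈ A, h j • z j‖ ^ 3 ≤ 6 * c ^ 3 * ∑ j ∈ A, μ j := by
    intro A hA c hc h hh
    rcases A.eq_empty_or_nonempty with rfl | ⟨i, hi⟩
    · simp
    rcases hc.eq_or_lt with rfl | hc
    · rw [Finset.sum_eq_zero fun j hj => by rw [norm_le_zero_iff.1 (hh j hj), zero_smul]]
      simp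
    have h1 := hX.restricted_of_almost_max hβ hmax hz hzβ.le hA
      (g := fun j => (((c⁻¹ : ℝ) : 𝕜)) * h j) fun j hj => by
        rw [norm_mul, RCLike.norm_ofReal, abs_of_pos (by positivity), inv_mul_le_iff₀ hc, mul_one]
        exact hh j hj
    simp only [mul_smul, ← Finset.smul_sum] at h1
    rw [norm_smul, RCLike.norm_ofReal, abs_of_pos (by positivity), mul_pow, inv_pow,
      inv_mul_le_iff₀ (by positivity)] at h1
    have h2 : ∑ j ∈ A, ‖v j (z j)‖ / β ≤ ∑ j ∈ A, μ j :=
      Finset.sum_le_sum fun j _ => by simp only [hμ]; linarith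
    have h3 : ε ≤ ∑ j ∈ A, μ j :=
      le_trans (le_add_of_nonneg_left (by positivity))
        (Finset.single_le_sum (f := μ) (fun j _ => (hμ0 j).le) hi)
    refine h1.trans ?_
    have : 0 < c ^ 3 := by positivity
    nlinarith
  -- This weight turns the unit ball of `ℓ_t` into that of `ℓ_t(μ)`.
  set y : ℕ → X := fun j => (((μ j ^ (-(1 / t)) : ℝ) : 𝕜)) • z j with hy
  have ht0 : t ≠ 0 := hpt.symm.ne_zero
  have hyK := hK y C hC0 fun a ha => by
    simp only [hy, smul_smul]
    refine norm_sum_le_of_restricted ht (fun j => (hμ0 j).le) hμs restricted ?_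
    refine le_trans (le_of_eq (Finset.sum_congr rfl fun j _ => ?_)) ha
    rw [norm_mul, RCLike.norm_ofReal, abs_of_pos (Real.rpow_pos_of_pos (hμ0 j) _),
      Real.mul_rpow (norm_nonneg _) (Real.rpow_nonneg (hμ0 j).le _), ← Real.rpow_mul (hμ0 j).le,
      mul_assoc, ← Real.rpow_add_one (hμ0 j).ne']
    have : -(1 / t) * t + 1 = 0 := by field_simp; ring
    rw [this, Real.rpow_zero, mul_one]
  have hd : ∀ j, ‖v j (z j)‖ = μ j ^ (1 / t) * ‖v j (y j)‖ := fun j => by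
    simp only [hy]
    rw [map_smul, norm_smul, RCLike.norm_ofReal, abs_of_pos (Real.rpow_pos_of_pos (hμ0 j) _),
      ← mul_assoc, ← Real.rpow_add (hμ0 j), add_neg_cancel, Real.rpow_zero, one_mul]
  have hsum : ∑ j ∈ s, ‖v j (z j)‖ ≤ 2 * (K * C) := by
    calc ∑ j ∈ s, ‖v j (z j)‖ = ∑ j ∈ s, μ j ^ (1 / t) * ‖v j (y j)‖ :=
          Finset.sum_congr rfl fun j _ => hd j
      _ ≤ (∑ j ∈ s, (μ j ^ (1 / t)) ^ t) ^ (1 / t) * (∑ j ∈ s, ‖v j (y j)‖ ^ p) ^ (1 / p) :=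
          Real.inner_le_Lp_mul_Lq_of_nonneg s hpt.symm
            (fun j _ => Real.rpow_nonneg (hμ0 j).le _) fun j _ => norm_nonneg _
      _ ≤ 2 ^ (1 / t) * ((K * C) ^ p) ^ (1 / p) := by
          have e : ∀ j, (μ j ^ (1 / t)) ^ t = μ j := fun j => by
            rw [← Real.rpow_mul (hμ0 j).le, one_div_mul_cancel ht0, Real.rpow_one]
          simp only [e]
          refine mul_le_mul
            (Real.rpow_le_rpow (Finset.sum_nonneg fun j _ => (hμ0 j).le) hμs
              (one_div_nonneg.2 hpt.symm.nonneg))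
            (Real.rpow_le_rpow (Finset.sum_nonneg fun j _ => Real.rpow_nonneg (norm_nonneg _) _)
              hyK (one_div_nonneg.2 hpt.nonneg))
            (Real.rpow_nonneg (Finset.sum_nonneg fun j _ => Real.rpow_nonneg (norm_nonneg _) _) _)
            (Real.rpow_nonneg zero_le_two _)
      _ ≤ 2 * (K * C) := by
          rw [← Real.rpow_mul (by positivity), mul_one_div_cancel hpt.ne_zero, Real.rpow_one]
          gcongr
          refine (Real.rpow_le_rpow_of_exponent_le one_le_two ?_).trans_eq (Real.rpow_one 2)
          rw [div_le_one hpt.symm.pos]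
          linarith
  -- Since `ε ≤ 1/2`, `β / 2 ≤ β (1 - ε) < ∑ ‖v_j z_j‖ ≤ 2KC`.
  nlinarith

/-- Operators that map `ℓ_p^w(X)` to `ℓ_p(Y)` map `ℓ_1^w(X)` to `ℓ_1(Y)`. -/
lemma CubeClarkson.exists_bound [CompleteSpace X] (hX : CubeClarkson X) {p : ℝ} (hp1 : 1 < p)
    (hp : p < 3 / 2) {v : ℕ → X →L[𝕜] Y}
    (H : ∀ y, WeaklySummable 𝕜 p y → Memℓp (fun j => v j (y j)) (ENNReal.ofReal p)) :
    ∃ B : ℝ, 0 ≤ B ∧ ∀ (s : Finset ℕ) (z : ℕ → X) (c : ℝ), 0 < c →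
      (∀ f : ℕ → 𝕜, (∀ j, ‖f j‖ ≤ 1) → ‖∑ j ∈ s, f j • z j‖ ≤ c) →
      ∑ j ∈ s, ‖v j (z j)‖ ≤ B * c := by
  have hpt := Real.HolderConjugate.conjExponent hp1
  set t := p.conjExponent with htdef
  have ht : 3 < t := by
    rw [htdef, Real.conjExponent, lt_div_iff₀ (by linarith)]
    linarith
  obtain ⟨K, hK0, hK⟩ := exists_uniform_bound hpt H
  refine ⟨max 0 (4 * (K * (3 + 4 * (1 - (2 : ℝ) ^ ((3 - t) / 3))⁻¹))), le_max_left _ _,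
    fun s => ?_⟩
  set S : Set ℝ := {d | ∃ z : ℕ → X,
      (∀ f : ℕ → 𝕜, (∀ j, ‖f j‖ ≤ 1) → ‖∑ j ∈ s, f j • z j‖ ≤ 1) ∧
      d = ∑ j ∈ s, ‖v j (z j)‖} with hS
  have hbdd : BddAbove S := by
    refine ⟨∑ j ∈ s, ‖v j‖, ?_⟩
    rintro _ ⟨z, hz, rfl⟩
    refine Finset.sum_le_sum fun j hj => ?_
    have h1 := hz (fun i => if i = j then 1 else 0) fun i => by split_ifs <;> simp
    simp only [ite_smul, one_smul, zero_smul, Finset.sum_ite_eq', hj, if_true] at h1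
    exact ((v j).le_opNorm _).trans (mul_le_of_le_one_right (norm_nonneg _) h1)
  have hne : S.Nonempty := ⟨0, fun _ => 0, by simp, by simp⟩
  have hmax : ∀ z : ℕ → X, ∀ c : ℝ, 0 < c →
      (∀ f : ℕ → 𝕜, (∀ j, ‖f j‖ ≤ 1) → ‖∑ j ∈ s, f j • z j‖ ≤ c) →
      ∑ j ∈ s, ‖v j (z j)‖ ≤ sSup S * c := by
    intro z c hc hz
    have h1 := le_csSup hbdd (a := ∑ j ∈ s, ‖v j ((((c⁻¹ : ℝ) : 𝕜)) • z j)‖)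
      ⟨_, fun f hf => by
        simp only [smul_comm (f _), ← Finset.smul_sum]
        rw [norm_smul, RCLike.norm_ofReal, abs_of_pos (by positivity), inv_mul_le_iff₀ hc, mul_one]
        exact hz f hf, rfl⟩
    simp only [map_smul, norm_smul, RCLike.norm_ofReal, ← Finset.mul_sum] at h1
    rw [abs_of_pos (by positivity), inv_mul_le_iff₀ hc] at h1
    linarith
  have hle : sSup S ≤ max 0 (4 * (K * (3 + 4 * (1 - (2 : ℝ) ^ ((3 - t) / 3))⁻¹))) := by
    rcases le_or_gt (sSup S) 0 with h | h
    · exact h.trans (le_max_left _ _)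
    refine le_trans ?_ (le_max_right _ _)
    refine hX.max_le hpt ht (hK s) hK0 h hmax ?_ fun β' hβ' => ?_
    · by_contra hs
      rw [Finset.not_nonempty_iff_eq_empty] at hs
      obtain ⟨_, ⟨z, -, rfl⟩, hd⟩ := exists_lt_of_lt_csSup hne h
      simp [hs] at hd
    · obtain ⟨_, ⟨z, hz, rfl⟩, hd⟩ := exists_lt_of_lt_csSup hne hβ'
      exact ⟨z, hz, hd⟩
  intro z c hc hz
  exact (hmax z c hc hz).trans (mul_le_mul_of_nonneg_right hle hc.le)

/-- Operators that map `ℓ_p^w(X)` to `ℓ_p(Y)` map `ℓ_r^w(X)` to `ℓ_r(Y)` for `1 ≤ r < p < 3 / 2`. -/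
lemma CubeClarkson.memℓp_of_weaklySummable [CompleteSpace X] (hX : CubeClarkson X) {p r : ℝ}
    (hr : 1 ≤ r) (hrp : r < p) (hp : p < 3 / 2) {v : ℕ → X →L[𝕜] Y}
    (H : ∀ y, WeaklySummable 𝕜 p y → Memℓp (fun j => v j (y j)) (ENNReal.ofReal p))
    {x : ℕ → X} (hx : WeaklySummable 𝕜 r x) :
    Memℓp (fun j => v j (x j)) (ENNReal.ofReal r) := by
  have hr0 : 0 < r := by linarith
  obtain ⟨B, hB0, hB⟩ := hX.exists_bound (hr.trans_lt hrp) hp H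
  obtain ⟨W, hW0, hW⟩ := (weaklySummable_iff hr0).1 hx
  have weighted : ∀ (s : Finset ℕ) (a : ℕ → ℝ) (c : ℝ), 0 < c → (∀ j, 0 ≤ a j) →
      (∀ φ : X →L[𝕜] 𝕜, ‖φ‖ ≤ 1 → ∑ j ∈ s, a j * ‖φ (x j)‖ ≤ c) →
      ∑ j ∈ s, ‖v j (x j)‖ * a j ≤ B * c := by
    intro s a c hc ha h
    have h1 := hB s (fun j => (a j : 𝕜) • x j) c hc fun f hf => by
      obtain ⟨φ, hφ, hφz⟩ := exists_dual_vector'' 𝕜 (∑ j ∈ s, f j • (a j : 𝕜) • x j)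
      have h2 : ‖∑ j ∈ s, f j • (a j : 𝕜) • x j‖ = ‖φ (∑ j ∈ s, f j • (a j : 𝕜) • x j)‖ := by
        rw [hφz, RCLike.norm_ofReal, abs_norm]
      rw [h2, map_sum]
      refine (norm_sum_le _ _).trans ((Finset.sum_le_sum fun j _ => ?_).trans (h φ hφ))
      rw [map_smul, map_smul, norm_smul, norm_smul, RCLike.norm_ofReal, abs_of_nonneg (ha j)]
      exact mul_le_of_le_one_left (mul_nonneg (ha j) (norm_nonneg _)) (hf j)
    refine le_trans (le_of_eq (Finset.sum_congr rfl fun j _ => ?_)) h1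
    rw [map_smul, norm_smul, RCLike.norm_ofReal, abs_of_nonneg (ha j), mul_comm]
  -- `W + 1` replaces `W` only to have a positive bound.
  refine memℓp_gen' (C := (B * (W + 1)) ^ r) fun s => ?_
  rw [ENNReal.toReal_ofReal hr0.le]
  rcases hr.eq_or_lt with rfl | hr1
  · have := weighted s (fun _ => 1) (W + 1) (by linarith) (fun _ => zero_le_one) fun φ hφ => by
      have := hW φ hφ s
      simp only [Real.rpow_one] at this
      simp only [one_mul]
      linarith
    simpa using this
  -- For `a` in the unit ball of `ℓ_{r'}`, Hölder makes `(a_j x_j)` weakly `1`-summable; duality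
  -- recovers the `ℓ_r` sum.
  · have hrt := Real.HolderConjugate.conjExponent hr1
    refine Real.sum_rpow_le_of_dual s (fun _ => norm_nonneg _) hrt fun a ha hat => ?_
    refine weighted s a (W + 1) (by linarith) ha fun φ hφ => ?_
    have h1 := Real.inner_le_Lp_mul_Lq_of_nonneg s hrt.symm (fun j _ => ha j)
      (fun j _ => norm_nonneg (φ (x j)))
    have h2 : (∑ j ∈ s, a j ^ r.conjExponent) ^ (1 / r.conjExponent) ≤ 1 :=
      Real.rpow_le_one (Finset.sum_nonneg fun j _ => Real.rpow_nonneg (ha j) _) hat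
        (one_div_nonneg.2 hrt.symm.nonneg)
    have h3 : (∑ j ∈ s, ‖φ (x j)‖ ^ r) ^ (1 / r) ≤ W := by
      refine (Real.rpow_le_rpow (by positivity) (hW φ hφ s) (by positivity)).trans_eq ?_
      rw [← Real.rpow_mul hW0, mul_one_div_cancel hr0.ne', Real.rpow_one]
    have h4 := mul_le_mul h2 h3 (by positivity) zero_le_one
    linarith

end Extrapolation

/-! ### Multilinear operators: freezing all but one argument -/

/-- Lowering the exponents from `p` to `r` in the spaces where they change, provided they do so in
a space satisfying the Clarkson type inequality. -/
lemma absolutelySumming_subset {𝕜 : Type*} [RCLike 𝕜] {n : ℕ} {X : Fin n → Type*} {Y : Type*}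
    [∀ k, NormedAddCommGroup (X k)] [∀ k, NormedSpace 𝕜 (X k)]
    [NormedAddCommGroup Y] [NormedSpace 𝕜 Y] {i : Fin n} [CompleteSpace (X i)]
    (hX : CubeClarkson (X i)) {p r : ℝ} (hr : 1 ≤ r) (hrp : r < p) (hp : p < 3 / 2)
    {a b : Fin n → ℝ} (hai : a i = p) (hbi : b i = r) (hb : ∀ k, 0 < b k) (hba : ∀ k, b k ≤ a k) :
    absolutelySumming (𝕜 := 𝕜) X Y p a ⊆ absolutelySumming (𝕜 := 𝕜) X Y r b := by
  intro T hT x hx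
  have H : ∀ y : ℕ → X i, WeaklySummable 𝕜 p y →
      Memℓp (fun j => T.toContinuousLinearMap (fun k => x k j) i (y j)) (ENNReal.ofReal p) := by
    intro y hy
    have h1 := hT (Function.update x i y) fun k => by
      rcases eq_or_ne k i with rfl | hk
      · simpa [hai] using hy
      · simpa [hk] using (hx k).mono (hb k) (hba k)
    convert h1 using 3 with j
    rw [ContinuousMultilinearMap.toContinuousLinearMap_apply]
    congr 1
    ext k
    rcases eq_or_ne k i with rfl | hk
    · simp
    · simp [hk]
  have h2 := hX.memℓp_of_weaklySummable hr hrp hp H (hbi ▸ hx i)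
  simpa [ContinuousMultilinearMap.toContinuousLinearMap_apply] using h2

theorem mainTheorem4 {𝕜 : Type*} [RCLike 𝕜] {n : ℕ} (hn : 3 ≤ n)
    (X : Fin n → Type*) (Y : Type*)
    [∀ k, NormedAddCommGroup (X k)] [∀ k, NormedSpace 𝕜 (X k)] [∀ k, CompleteSpace (X k)]
    [NormedAddCommGroup Y] [NormedSpace 𝕜 Y] [CompleteSpace Y]
    -- the first three spaces are `ℓ_3` (up to linear isometry), the others are arbitrary
    (hX : ∀ k : Fin n, k.val < 3 → Nonempty (X k ≃ₗᵢ[𝕜] EllThree 𝕜))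
    (p r : ℝ) (hr : 1 ≤ r) (hrp : r < p) (hp : p < 3 / 2) :
    (∀ q : ℝ, 1 ≤ q →
      absolutelySumming (𝕜 := 𝕜) X Y p (firstThree p q) ⊆
        absolutelySumming (𝕜 := 𝕜) X Y r (firstThree r q)) ∧
    absolutelySumming (𝕜 := 𝕜) X Y p (fun _ => p) ⊆
      absolutelySumming (𝕜 := 𝕜) X Y r (fun _ => r) := by

  obtain ⟨e⟩ := hX ⟨0, by omega⟩ (by norm_num)
  have hC := (cubeClarkson_ellThree 𝕜).of_linearIsometryEquiv e
  refine ⟨fun q hq => ?_, ?_⟩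
  · refine absolutelySumming_subset hC hr hrp hp (by simp [firstThree]) (by simp [firstThree])
      (fun k => ?_) fun k => ?_
    · unfold firstThree
      split_ifs <;> linarith
    · unfold firstThree
      split_ifs <;> linarith
  · exact absolutelySumming_subset hC hr hrp hp rfl rfl (fun _ => by linarith) fun _ => hrp.le
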